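/- For an integer $n\ge 0$ let $b_{13}(n)$ denote the number of $13$-regular partitions of $n$, that is, partitions of $n$ none of whose parts is divisible by $13$ (so $b_{13}(0)=1$), and set $b_{13}(n)=0$ for $n<0$. Let $\alpha,n\ge 0$ be integers and let $p_1,\dots,p_{\alpha+1}$ be odd primes (not necessarily distinct) such that $b_{13}\left(\frac{p_i-1}{2}\right)\equiv 0\pmod{13}$ for every $1\le i\le \alpha+1$. Then for every integer $j\not\equiv 0\pmod{p_{\alpha+1}}$, \[ b_{13}\left(p_1^2\cdots p_{\alpha+1}^2\,n+\frac{p_1^2\cdots p_\alpha^2\,p_{\alpha+1}(2j+p_{\alpha+1})-1}{2}\right)\equiv 0\pmod{13}. \] -/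

import Mathlib

/-- The number `b_ℓ(n)` of `ℓ`-regular partitions of the integer `n`, i.e. partitions of `n` none
of whose parts is divisible by `ℓ`; it is `0` for `n < 0`. -/
def regularPartitionCount (ℓ : ℕ) (n : ℤ) : ℕ :=
  if n < 0 then 0 else (Nat.Partition.restricted n.toNat (fun i => ¬ ℓ ∣ i)).card

/-! Modulo 13 the generating function of `b_13` is `∏ (1 - q^m)^12`, so `b_13(n) ≡ a(2n+1)`, where
`η(2z)^12 = ∑ a(n) q^n` (`natCast_regularPartitionCount`). This form is a Hecke eigenform, so `a(pn)
+ p^5 a(n/p) = a(p) a(n)` for odd primes `p` (`etaCoeff_hecke`). If `13 ∣ a(p)`, then `a(pn) ≡ 0`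
when `p ∤ n`, and `a(p^2 n) ≡ -p^5 a(n)`. The theorem follows because twice the given argument plus
one is `p_1^2 ⋯ p_α^2 · q · M` with `q = p_{α+1}` and `M ≡ 2j`, a nonzero residue mod `q`.

The eigenform property is proved at level one: `η^12` has weight 6 and a sign character on `SL(2,
ℤ)`, and its Hecke image has the same character. Their product is a cusp form of weight 12 and level
one, hence `c Δ = c η^24`; dividing by `η^12` gives `exists_heckeEta_eq`. -/

section EtaHecke

open ModularForm MatrixGroups Filter Complex
open UpperHalfPlane hiding I
open scoped Real Topology

/-! ### Transformation of `η^12` under the modular group -/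

/-- `η ^ 12` as a function on the upper half-plane. -/
noncomputable def etaPow (z : ℍ) : ℂ := η z ^ 12

lemma etaPow_ne_zero (z : ℍ) : etaPow z ≠ 0 := pow_ne_zero _ (eta_ne_zero z.2)

lemma etaPow_vadd_one (z : ℍ) : etaPow ((1 : ℝ) +ᵥ z) = -etaPow z := by
  have h : ∀ n, eta_q n ((1 : ℂ) + z) = eta_q n z := fun n ↦ by
    simp only [eta_q, Function.Periodic.qParam]
    rw [show 2 * π * I * (1 + (z : ℂ)) / ((1 : ℝ) : ℂ) =
      2 * π * I * z / ((1 : ℝ) : ℂ) + 2 * π * I by push_cast; ring, exp_periodic]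
  have h2 : Function.Periodic.qParam 24 ((1 : ℂ) + z) ^ 12
      = - Function.Periodic.qParam 24 (z : ℂ) ^ 12 := by
    simp only [Function.Periodic.qParam, ← Complex.exp_nat_mul]
    rw [show ((12 : ℕ) : ℂ) * (2 * π * I * (1 + (z : ℂ)) / ((24 : ℝ) : ℂ)) =
      ((12 : ℕ) : ℂ) * (2 * π * I * (z : ℂ) / ((24 : ℝ) : ℂ)) + π * I by push_cast; ring,
      exp_add, exp_pi_mul_I]
    ring
  simp only [etaPow, coe_vadd, ofReal_one, ModularForm.eta, mul_pow, h, h2]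
  ring

lemma etaPow_S_smul (z : ℍ) : etaPow (ModularGroup.S • z) = -(z : ℂ) ^ 6 * etaPow z := by
  have he : η (-(↑z)⁻¹) = (sqrt I)⁻¹ * (sqrt z * η z) := by
    simpa [neg_div] using eta_comp_eq_csqrt_I_inv z.2
  have hs : ∀ w : ℂ, w ≠ 0 → sqrt w ^ 12 = w ^ 6 := fun w hw ↦ by
    rw [sqrt_eq_exp hw, ← exp_nat_mul, show ((12 : ℕ) : ℂ) * (log w / 2) = (6 : ℕ) * log w by
      push_cast; ring, exp_nat_mul, exp_log hw]
  rw [etaPow, UpperHalfPlane.modular_S_smul]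
  simp only [inv_neg, he, mul_pow, inv_pow, hs _ I_ne_zero, hs _ z.ne_zero, etaPow]
  rw [show I ^ 6 = -1 by rw [show (6 : ℕ) = 2 * 3 by rfl, pow_mul, I_sq]; norm_num]
  ring

/-- The sign character of `SL(2, ℤ/2)`, which is isomorphic to `S₃`. -/
def slTwoSign : SL(2, ZMod 2) →* ℤ where
  -- The transpositions of `S₃` are exactly its elements of order two.
  toFun M := if M * M = 1 ∧ M ≠ 1 then -1 else 1
  map_one' := by decide
  map_mul' := by decide

/-- The sign character of `SL(2, ℤ)`, by reduction modulo two. -/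
def modTwoSign : SL(2, ℤ) →* ℤ :=
  slTwoSign.comp (Matrix.SpecialLinearGroup.map (Int.castRingHom (ZMod 2)))

lemma modTwoSign_S : modTwoSign ModularGroup.S = -1 := by decide

lemma modTwoSign_T : modTwoSign ModularGroup.T = -1 := by decide

/-- An even diagonal forces the reduction mod 2 to be the antidiagonal involution. -/
lemma modTwoSign_of_even {γ : SL(2, ℤ)} (ha : Even (γ 0 0)) (hd : Even (γ 1 1)) :
    modTwoSign γ = -1 := by
  have key : ∀ M : SL(2, ZMod 2), M 0 0 = 0 → M 1 1 = 0 → slTwoSign M = -1 := by decide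
  refine key _ ?_ ?_
  · simpa using (ZMod.intCast_zmod_eq_zero_iff_dvd (γ 0 0) 2).2 ha.two_dvd
  · simpa using (ZMod.intCast_zmod_eq_zero_iff_dvd (γ 1 1) 2).2 hd.two_dvd

lemma etaPow_slash (γ : SL(2, ℤ)) : etaPow ∣[(6 : ℤ)] γ = (modTwoSign γ : ℂ) • etaPow := by
  have hγ : γ ∈ Subgroup.closure {ModularGroup.S, ModularGroup.T} := by
    simp [SpecialLinearGroup.SL2Z_generators]
  induction hγ using Subgroup.closure_induction with
  | mem x hx =>
    rcases hx with rfl | rfl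
    · ext z
      rw [SL_slash_apply, etaPow_S_smul, ModularGroup.denom_S, modTwoSign_S]
      simp
      field_simp [z.ne_zero]
    · ext z
      rw [SL_slash_apply, UpperHalfPlane.modular_T_smul, etaPow_vadd_one, modTwoSign_T,
        ModularGroup.denom_apply]
      simp [ModularGroup.T]
  | one => simp
  | mul x y _ _ hx hy =>
    rw [SlashAction.slash_mul, hx, SL_smul_slash, hy, map_mul]
    ext; simp [mul_assoc]
  | inv x _ hx =>
    have h := congrArg (· ∣[(6 : ℤ)] x⁻¹) hx
    simp only [← SlashAction.slash_mul, SL_smul_slash, mul_inv_cancel, SlashAction.slash_one] at h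
    have h1 : (modTwoSign x : ℂ) * modTwoSign x⁻¹ = 1 := by
      rw [← Int.cast_mul, ← map_mul]; simp
    ext z
    have h2 := congrFun h z
    simp only [Pi.smul_apply, smul_eq_mul] at h2 ⊢
    rw [h2, ← mul_assoc, mul_comm (modTwoSign x⁻¹ : ℂ), h1, one_mul]

lemma eta_pow_add_one {z : ℂ} (hz : 0 < z.im) : η (z + 1) ^ 12 = -η z ^ 12 := by
  simpa [etaPow, add_comm] using etaPow_vadd_one ⟨z, hz⟩

lemma eta_pow_add_nat {z : ℂ} (hz : 0 < z.im) (n : ℕ) :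
    η (z + n) ^ 12 = (-1) ^ n * η z ^ 12 := by
  induction n with
  | zero => simp
  | succ n ih =>
    rw [Nat.cast_succ, ← add_assoc, eta_pow_add_one (by simpa using hz), ih]; ring

lemma eta_pow_neg_inv {z : ℂ} (hz : 0 < z.im) : η (-z⁻¹) ^ 12 = -z ^ 6 * η z ^ 12 := by
  have h := etaPow_S_smul ⟨z, hz⟩
  rw [UpperHalfPlane.modular_S_smul] at h
  simp only [etaPow, inv_neg] at h
  exact h

lemma eta_pow_moebius {z : ℂ} (hz : 0 < z.im) {a b c d : ℤ} (hdet : a * d - b * c = 1)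
    (ha : Even a) (hd : Even d) :
    η ((a * z + b) / (c * z + d)) ^ 12 = -(c * z + d) ^ 6 * η z ^ 12 := by
  obtain ⟨γ, h00, h01, h10, h11⟩ :
      ∃ γ : SL(2, ℤ), γ 0 0 = a ∧ γ 0 1 = b ∧ γ 1 0 = c ∧ γ 1 1 = d :=
    ⟨⟨!![a, b; c, d], by simp [Matrix.det_fin_two, hdet]⟩, rfl, rfl, rfl, rfl⟩
  obtain ⟨w, rfl⟩ : ∃ w : ℍ, (w : ℂ) = z := ⟨.mk z hz, rfl⟩
  have h := congrFun (etaPow_slash γ) w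
  have h0 := denom_ne_zero γ w
  have h2 : ((γ • w : ℍ) : ℂ) = (a * w + b) / (c * w + d) := by
    rw [coe_specialLinearGroup_apply, h00, h01, h10, h11]; simp
  rw [SL_slash_apply, modTwoSign_of_even (h00 ▸ ha) (h11 ▸ hd)] at h
  rw [ModularGroup.denom_apply, h10, h11] at h h0
  rw [zpow_neg, mul_inv_eq_iff_eq_mul₀ (zpow_ne_zero _ h0)] at h
  simp only [etaPow, h2, Pi.smul_apply, smul_eq_mul] at h
  rw [h, show (6 : ℤ) = (6 : ℕ) by rfl, zpow_natCast]
  push_cast; ring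

lemma eta_pow_add_div_congr {z : ℂ} (hz : 0 < z.im) {p m n : ℕ} (hp : Odd p)
    (hmod : m ≡ n [MOD p]) (hodd : Odd (m + n)) :
    η ((z + m) / p) ^ 12 = -η ((z + n) / p) ^ 12 := by
  wlog hle : n ≤ m generalizing m n
  · rw [this hmod.symm (add_comm m n ▸ hodd) (by omega), neg_neg]
  obtain ⟨k, hk⟩ := (Nat.modEq_iff_dvd' hle).1 hmod.symm
  obtain rfl : m = n + p * k := by omega
  have hp0 : (p : ℂ) ≠ 0 := by exact_mod_cast hp.pos.ne'
  have hkodd : Odd k := by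
    by_contra hk'
    rw [Nat.not_odd_iff_even] at hk'
    rw [show n + p * k + n = 2 * n + p * k by ring] at hodd
    exact (Nat.not_odd_iff_even.2 ((even_two_mul n).add (hk'.mul_left p))) hodd
  have him : 0 < ((z + n) / p : ℂ).im := by
    rw [div_natCast_im]
    have : (0 : ℝ) < p := by exact_mod_cast hp.pos
    simpa using div_pos hz this
  rw [show (z + ((n + p * k : ℕ) : ℂ)) / p = (z + n) / p + k by push_cast; field_simp; ring,
    eta_pow_add_nat him, hkodd.neg_one_pow]
  ring

/-! ### The Hecke image of `η^12` -/

/-- The image of `η ^ 12` under `p` times the Hecke operator of weight six at the odd prime `p`. -/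
noncomputable def heckeEta (p : ℕ) [NeZero p] (z : ℂ) : ℂ :=
  -- Since `η^12` has period 2 only, even shifts are needed for the terms to depend on `b` mod `p`
  -- alone.
  p ^ 6 * η (p * z) ^ 12 + ∑ b : ZMod p, η ((z + (2 * b.val : ℕ)) / p) ^ 12

section
variable {p : ℕ} [Fact p.Prime]

lemma im_natCast_mul_pos {z : ℂ} (hz : 0 < z.im) : 0 < (p * z : ℂ).im := by
  have : (0 : ℝ) < p := by exact_mod_cast (Fact.out : p.Prime).pos
  simpa using mul_pos this hz

lemma im_add_div_pos {z : ℂ} (hz : 0 < z.im) (n : ℕ) : 0 < ((z + n) / p : ℂ).im := by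
  have : (0 : ℝ) < p := by exact_mod_cast (Fact.out : p.Prime).pos
  rw [div_natCast_im]
  simpa using div_pos hz this

lemma heckeEta_add_one (hp : Odd p) {z : ℂ} (hz : 0 < z.im) :
    heckeEta p (z + 1) = -heckeEta p z := by
  have h1 : η (p * (z + 1)) ^ 12 = -η (p * z) ^ 12 := by
    rw [mul_add, mul_one, eta_pow_add_nat (im_natCast_mul_pos hz), hp.neg_one_pow]; ring
  -- Here `(p + 1) / 2` is the inverse of 2 mod `p`; the two shifts differ by an odd multiple of
  -- `p`, whence the sign.
  have h2 : ∀ b : ZMod p, η ((z + 1 + (2 * b.val : ℕ)) / p) ^ 12 =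
      -η ((z + (2 * (b + ((p + 1) / 2 : ℕ)).val : ℕ)) / p) ^ 12 := fun b ↦ by
    have := eta_pow_add_div_congr hz (m := 1 + 2 * b.val)
      (n := 2 * (b + ((p + 1) / 2 : ℕ)).val) hp ?_ ?_
    · rw [← this]; push_cast; ring_nf
    · rw [← ZMod.natCast_eq_natCast_iff]
      have : ((2 * ((p + 1) / 2) : ℕ) : ZMod p) = 1 := by
        rw [Nat.two_mul_div_two_of_even (by grind)]; simp
      push_cast [ZMod.natCast_zmod_val] at this ⊢
      rw [mul_add, this]; ring
    · grind
  have h3 := Equiv.sum_comp (Equiv.addRight (((p + 1) / 2 : ℕ) : ZMod p))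
    (fun b : ZMod p ↦ η ((z + (2 * b.val : ℕ)) / p) ^ 12)
  simp only [Equiv.coe_addRight] at h3
  rw [heckeEta, heckeEta, h1, Finset.sum_congr rfl fun b _ ↦ h2 b, Finset.sum_neg_distrib, h3]
  ring

/-- With `4bc + 1 = pe`, this is the factorisation `(1, 2b; 0, p) S = (2b, -e; p, -2c) (1, 2c; 0,
p)`, whose first right-hand factor has determinant 1 and even diagonal. -/
lemma eta_pow_neg_inv_add_div {z : ℂ} (hz : 0 < z.im) {b c : ℕ} (h : p ∣ 4 * b * c + 1) :
    η ((-z⁻¹ + (2 * b : ℕ)) / p) ^ 12 = -z ^ 6 * η ((z + (2 * c : ℕ)) / p) ^ 12 := by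
  obtain ⟨e, he⟩ := h
  have hp0 : (p : ℂ) ≠ 0 := by exact_mod_cast (Fact.out : p.Prime).ne_zero
  have hz0 : z ≠ 0 := by rintro rfl; simp at hz
  have heZ : (4 * b * c + 1 : ℤ) = p * e := by exact_mod_cast he
  have heC : (4 * b * c + 1 : ℂ) = p * e := by exact_mod_cast he
  have key := eta_pow_moebius (im_add_div_pos (p := p) hz (2 * c)) (a := 2 * b) (b := -e) (c := p)
    (d := -2 * c) (by linear_combination -heZ) (by simp) (by simp)
  push_cast at key ⊢
  have hden : (p : ℂ) * ((z + 2 * c) / p) + -2 * c = z := by field_simp; ring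
  rw [hden] at key
  rw [← key]
  congr 2
  field_simp
  linear_combination (-1 : ℂ) * heC

lemma heckeEta_neg_inv (hp : Odd p) {z : ℂ} (hz : 0 < z.im) :
    heckeEta p (-z⁻¹) = -z ^ 6 * heckeEta p z := by
  have hp0 : (p : ℂ) ≠ 0 := by exact_mod_cast (Fact.out : p.Prime).ne_zero
  have hz0 : z ≠ 0 := by rintro rfl; simp at hz
  have h4 : (4 : ZMod p) ≠ 0 := by
    intro h
    have : (p : ℕ) ∣ 2 ^ 2 := by
      rw [← ZMod.natCast_eq_zero_iff]; push_cast; rw [← h]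
    have := (Fact.out : p.Prime).dvd_of_dvd_pow this
    rw [Nat.prime_dvd_prime_iff_eq Fact.out Nat.prime_two] at this
    subst this
    exact absurd hp (by decide)
  -- `z ↦ -1/z` swaps the `η(pz)` term with the `b = 0` term and permutes the others by `b ↦
  -- -1/(4b)`.
  have hA : (p : ℂ) ^ 6 * η (p * -z⁻¹) ^ 12 = -z ^ 6 * η (z / p) ^ 12 := by
    have := eta_pow_neg_inv (z := z / p) (by simpa using im_add_div_pos (p := p) hz 0)
    rw [show (p : ℂ) * -z⁻¹ = -(z / p)⁻¹ by field_simp, this]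
    field_simp
  have hB : η (-z⁻¹ / p) ^ 12 = -z ^ 6 * (p ^ 6 * η (p * z) ^ 12) := by
    rw [show -z⁻¹ / (p : ℂ) = -(p * z)⁻¹ by field_simp, eta_pow_neg_inv (im_natCast_mul_pos hz)]
    ring
  have hC : ∑ b ∈ Finset.univ.erase (0 : ZMod p), η ((-z⁻¹ + (2 * b.val : ℕ)) / p) ^ 12 =
      ∑ b ∈ Finset.univ.erase (0 : ZMod p), -z ^ 6 * η ((z + (2 * b.val : ℕ)) / p) ^ 12 := by
    refine Finset.sum_nbij' (fun b ↦ -(4 * b)⁻¹) (fun b ↦ -(4 * b)⁻¹) ?_ ?_ ?_ ?_ ?_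
    · simp [h4]
    · simp [h4]
    · intro b hb
      have : b ≠ 0 := by simpa using hb
      field_simp
    · intro b hb
      have : b ≠ 0 := by simpa using hb
      field_simp
    · intro b hb
      have : b ≠ 0 := by simpa using hb
      apply eta_pow_neg_inv_add_div hz
      rw [← ZMod.natCast_eq_zero_iff]
      push_cast [ZMod.natCast_zmod_val]
      field_simp
      ring
  rw [heckeEta, heckeEta, ← Finset.add_sum_erase _ _ (Finset.mem_univ (0 : ZMod p)),
    ← Finset.add_sum_erase _ _ (Finset.mem_univ (0 : ZMod p)), hC, ← Finset.mul_sum, hA]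
  simp only [ZMod.val_zero, mul_zero, Nat.cast_zero, add_zero, hB]
  ring

lemma differentiableAt_heckeEta {z : ℂ} (hz : 0 < z.im) : DifferentiableAt ℂ (heckeEta p) z := by
  unfold heckeEta
  have h1 : DifferentiableAt ℂ (fun w : ℂ ↦ η (p * w)) z :=
    DifferentiableAt.comp (f := fun w : ℂ ↦ p * w) z
      (differentiableAt_eta_of_mem_upperHalfPlaneSet (im_natCast_mul_pos hz)) (by fun_prop)
  have h2 (n : ℕ) : DifferentiableAt ℂ (fun w : ℂ ↦ η ((w + n) / p)) z :=
    DifferentiableAt.comp (f := fun w : ℂ ↦ (w + n) / p) z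
      (differentiableAt_eta_of_mem_upperHalfPlaneSet (im_add_div_pos hz n)) (by fun_prop)
  exact ((h1.fun_pow 12).const_mul _).fun_add
    (DifferentiableAt.fun_sum fun (b : ZMod p) _ ↦ (h2 (2 * b.val)).fun_pow 12)

lemma tendsto_etaPow_atImInfty : Tendsto etaPow atImInfty (𝓝 0) := by
  have h := discriminant_isZeroAtImInfty
  have h2 : Tendsto (fun z ↦ ‖etaPow z‖ ^ 2) atImInfty (𝓝 0) := by
    have := h.norm
    rw [norm_zero] at this
    refine this.congr fun z ↦ ?_
    rw [discriminant, etaPow, ← norm_pow, ← pow_mul]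
  rw [tendsto_zero_iff_norm_tendsto_zero]
  have h3 := (Real.continuous_sqrt.tendsto 0).comp h2
  simpa [Function.comp_def, Real.sqrt_sq] using h3

lemma tendsto_heckeEta_atImInfty : Tendsto (fun z : ℍ ↦ heckeEta p z) atImInfty (𝓝 0) := by
  have hpR : (0 : ℝ) < p := by exact_mod_cast (Fact.out : p.Prime).pos
  have h1 : Tendsto (fun z : ℍ ↦ η (p * z) ^ 12) atImInfty (𝓝 0) := by
    have : Tendsto (fun z : ℍ ↦ (⟨p * z, im_natCast_mul_pos z.2⟩ : ℍ)) atImInfty atImInfty := by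
      rw [atImInfty, tendsto_comap_iff]
      refine (tendsto_comap.const_mul_atTop hpR).congr fun z ↦ ?_
      simp [← coe_im]
    exact (tendsto_etaPow_atImInfty.comp this).congr fun z ↦ by simp only [Function.comp, etaPow]
  have h2 (n : ℕ) : Tendsto (fun z : ℍ ↦ η ((z + n) / p) ^ 12) atImInfty (𝓝 0) := by
    have : Tendsto (fun z : ℍ ↦ (⟨(z + n) / p, im_add_div_pos z.2 n⟩ : ℍ))
        atImInfty atImInfty := by
      rw [atImInfty, tendsto_comap_iff]
      refine (tendsto_comap.atTop_div_const hpR).congr fun z ↦ ?_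
      simp [← coe_im, div_natCast_im]
    exact (tendsto_etaPow_atImInfty.comp this).congr fun z ↦ by simp only [Function.comp, etaPow]
  unfold heckeEta
  simpa using (h1.const_mul ((p : ℂ) ^ 6)).add
    (tendsto_finsetSum Finset.univ fun (b : ZMod p) _ ↦ h2 (2 * b.val))

/-- The product of `η ^ 12` and its image under the Hecke operator, a cusp form of level one. -/
noncomputable def etaMulHecke (p : ℕ) [Fact p.Prime] (hp : Odd p) : CuspForm 𝒮ℒ 12 :=
  have hS : (fun z : ℍ ↦ etaPow z * heckeEta p z) ∣[(12 : ℤ)] ModularGroup.S =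
      fun z : ℍ ↦ etaPow z * heckeEta p z := by
    ext z
    rw [SL_slash_apply, etaPow_S_smul, ModularGroup.denom_S, UpperHalfPlane.modular_S_smul]
    simp only [inv_neg, heckeEta_neg_inv hp z.2]
    rw [zpow_neg, show (12 : ℤ) = (12 : ℕ) by rfl, zpow_natCast]
    field_simp [z.ne_zero]
  have hT : (fun z : ℍ ↦ etaPow z * heckeEta p z) ∣[(12 : ℤ)] ModularGroup.T =
      fun z : ℍ ↦ etaPow z * heckeEta p z := by
    ext z
    rw [SL_slash_apply, UpperHalfPlane.modular_T_smul, etaPow_vadd_one, coe_vadd,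
      ModularGroup.denom_apply, add_comm, ofReal_one, heckeEta_add_one hp z.2]
    simp [ModularGroup.T]
  { toFun := fun z ↦ etaPow z * heckeEta p z
    slash_action_eq' A hA := by
      obtain ⟨A, rfl⟩ := hA
      exact SlashInvariantForm.slash_action_generators_SL2Z hS hT A
    holo' := by
      rw [UpperHalfPlane.mdifferentiable_iff]
      refine .congr (f := fun z ↦ η z ^ 12 * heckeEta p z)
        (fun z hz ↦ (((differentiableAt_eta_of_mem_upperHalfPlaneSet hz).pow
          12).mul (differentiableAt_heckeEta hz)).differentiableWithinAt) fun z hz ↦ ?_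
      simp [etaPow, ofComplex_apply_of_im_pos hz]
    zero_at_cusps' hc := by
      rw [Subgroup.IsArithmetic.isCusp_iff_isCusp_SL2Z] at hc
      rw [OnePoint.isZeroAt_iff_forall_SL2Z hc]
      intro γ _
      rw [SlashInvariantForm.slash_action_generators_SL2Z hS hT]
      simpa [IsZeroAtImInfty, ZeroAtFilter] using
        tendsto_etaPow_atImInfty.mul (tendsto_heckeEta_atImInfty (p := p)) }

/-- Level-one cusp forms of weight 12 are multiples of `Δ = η^24`, and `η^12` has no zeros to
obstruct cancelling. -/
theorem exists_heckeEta_eq (hp : Odd p) : ∃ c : ℂ, ∀ z : ℍ, heckeEta p z = c * etaPow z := by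
  obtain ⟨c, hc⟩ := CuspForm.exists_smul_discriminant_of_weight_eq_twelve (etaMulHecke p hp)
  refine ⟨c, fun z ↦ mul_left_cancel₀ (etaPow_ne_zero z) ?_⟩
  have h : c * discriminant z = etaPow z * heckeEta p z := DFunLike.congr_fun hc z
  rw [← h, discriminant, etaPow]
  ring

end

/-! ### The `q`-expansion of `η^12` -/

lemma hasSum_of_eq {f g : ℕ → ℂ} {a : ℂ} (hfg : ∀ n, f n = g n) (hg : HasSum g a) :
    HasSum f a := by
  rwa [funext hfg]

lemma tendstoLocallyUniformlyOn_iterate_deriv {ι : Type*} {φ : Filter ι} {U : Set ℂ}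
    {F : ι → ℂ → ℂ} {f : ℂ → ℂ} (hf : TendstoLocallyUniformlyOn F f φ U)
    (hF : ∀ i, DifferentiableOn ℂ (F i) U) (hU : IsOpen U) (k : ℕ) :
    TendstoLocallyUniformlyOn (fun i ↦ deriv^[k] (F i)) (deriv^[k] f) φ U := by
  induction k generalizing F f with
  | zero => simpa using hf
  | succ k ih =>
    simpa using ih (hf.deriv (.of_forall hF) hU) fun i ↦ (hF i).deriv hU

lemma Polynomial.iterate_deriv_eval_zero (P : Polynomial ℂ) (k : ℕ) :
    deriv^[k] (fun x ↦ P.eval x) 0 = k.factorial * P.coeff k := by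
  have h : ∀ (k : ℕ) (P : Polynomial ℂ), deriv^[k] (fun x ↦ P.eval x) =
      fun x ↦ (Polynomial.derivative^[k] P).eval x := fun k ↦ by
    induction k with
    | zero => simp
    | succ k ih =>
      intro P
      rw [Function.iterate_succ_apply, Function.iterate_succ_apply, ← ih]
      congr 1
      ext x
      simp
  rw [h]
  beta_reduce
  rw [← Polynomial.coeff_zero_eq_eval_zero, Polynomial.coeff_iterate_derivative]
  simp [Nat.descFactorial_self]

-- Links the analytic and formal Euler products: partial products converge locally uniformly, so
-- their derivatives at 0 converge, while their formal coefficients are eventually constant.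
open PowerSeries in
lemma iterate_deriv_eulerProduct (k : ℕ) :
    deriv^[k] (fun q : ℂ ↦ ∏' n, (1 - q ^ (n + 1))) 0 =
      k.factorial * (pentagonalSeries ℂ).coeff k := by
  have h := multipliableLocallyUniformlyOn_one_sub_pow.hasProdLocallyUniformlyOn
  rw [hasProdLocallyUniformlyOn_iff_tendstoLocallyUniformlyOn] at h
  have h1 := (tendstoLocallyUniformlyOn_iterate_deriv h (fun s ↦ by fun_prop)
    Metric.isOpen_ball k).tendsto_at
    (Metric.mem_ball_self one_pos)
  refine tendsto_nhds_unique h1 (tendsto_nhds_of_eventually_eq ?_)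
  filter_upwards [coeff_prod_one_sub_X_pow_eventually_eq ℂ k] with s hs
  have h2 : (fun q : ℂ ↦ ∏ i ∈ s, (1 - q ^ (i + 1))) =
      fun q ↦ (∏ i ∈ s, (1 - Polynomial.X ^ (i + 1)) : Polynomial ℂ).eval q := by
    ext q; simp [Polynomial.eval_prod]
  rw [h2, Polynomial.iterate_deriv_eval_zero, ← hs]
  congr 1
  rw [← Polynomial.coeff_coe]
  congr 1
  rw [← Polynomial.coeToPowerSeries.ringHom_apply, map_prod]
  simp

open PowerSeries in
lemma hasSum_pentagonalSeries_coeff {q : ℂ} (hq : ‖q‖ < 1) :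
    HasSum (fun n ↦ (pentagonalSeries ℂ).coeff n * q ^ n) (∏' n, (1 - q ^ (n + 1))) := by
  have h := hasSum_taylorSeries_on_ball (c := 0) (r := 1) differentiableOn_tprod_one_sub_pow
    (z := q) (by simpa using hq)
  refine hasSum_of_eq (fun n ↦ ?_) h
  rw [iteratedDeriv_eq_iterate, iterate_deriv_eulerProduct]
  have : (n.factorial : ℂ) ≠ 0 := by exact_mod_cast n.factorial_ne_zero
  simp
  field_simp

open PowerSeries in
lemma norm_coeff_pentagonalSeries_le (n : ℕ) : ‖(pentagonalSeries ℂ).coeff n‖ ≤ 1 := by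
  by_cases h : n ∈ Set.range pentagonal
  · obtain ⟨k, rfl⟩ := h
    rw [coeff_pentagonalSeries_pentagonal]
    rcases Int.even_or_odd k with hk | hk <;> simp [Int.negOnePow_even, Int.negOnePow_odd, hk]
  · simp [coeff_pentagonalSeries_eq_zero ℂ h]

-- Absolute summability is carried through the induction to justify the Cauchy products.
open PowerSeries in
lemma hasSum_pentagonalSeries_pow_coeff {q : ℂ} (hq : ‖q‖ < 1) (k : ℕ) :
    Summable (fun n ↦ ‖(pentagonalSeries ℂ ^ k).coeff n * q ^ n‖) ∧
    HasSum (fun n ↦ (pentagonalSeries ℂ ^ k).coeff n * q ^ n) ((∏' n, (1 - q ^ (n + 1))) ^ k) := by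
  induction k with
  | zero =>
    have h : ∀ n ≠ 0, (pentagonalSeries ℂ ^ 0).coeff n * q ^ n = 0 := fun n hn ↦ by
      simp [coeff_one, hn]
    constructor
    · exact summable_of_ne_finset_zero (s := {0}) fun n hn ↦ by
        rw [h n (by simpa using hn), norm_zero]
    · convert hasSum_single 0 h using 1
      simp
  | succ k ih =>
    have hs : Summable fun n ↦ ‖(pentagonalSeries ℂ).coeff n * q ^ n‖ := by
      refine Summable.of_nonneg_of_le (fun _ ↦ norm_nonneg _) (fun n ↦ ?_)
        (summable_geometric_of_lt_one (norm_nonneg q) hq)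
      rw [norm_mul, norm_pow]
      exact mul_le_of_le_one_left (by positivity) (norm_coeff_pentagonalSeries_le n)
    have hc : ∀ n, (pentagonalSeries ℂ ^ (k + 1)).coeff n * q ^ n =
        ∑ kl ∈ Finset.HasAntidiagonal.antidiagonal n,
          ((pentagonalSeries ℂ ^ k).coeff kl.1 * q ^ kl.1) *
          ((pentagonalSeries ℂ).coeff kl.2 * q ^ kl.2) := fun n ↦ by
      rw [pow_succ, coeff_mul, Finset.sum_mul]
      refine Finset.sum_congr rfl fun kl h ↦ ?_
      rw [← Finset.HasAntidiagonal.mem_antidiagonal.1 h, pow_add]; ring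
    have h1 := summable_norm_sum_mul_antidiagonal_of_summable_norm ih.1 hs
    refine ⟨by simpa only [hc] using h1, ?_⟩
    simp only [hc]
    rw [pow_succ, ← ih.2.tsum_eq, ← (hasSum_pentagonalSeries_coeff hq).tsum_eq,
      tsum_mul_tsum_eq_tsum_sum_antidiagonal_of_summable_norm ih.1 hs]
    exact h1.of_norm.hasSum

open PowerSeries in
lemma map_pentagonalSeries (R : Type*) [CommRing R] :
    PowerSeries.map (Int.castRingHom R) (pentagonalSeries ℤ) = pentagonalSeries R := by
  ext n
  by_cases h : n ∈ Set.range pentagonal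
  · obtain ⟨k, rfl⟩ := h
    simp
  · simp [coeff_pentagonalSeries_eq_zero _ h]

/-- The coefficients of `η(2z) ^ 12 = ∑ a(n) e(nz)`. -/
noncomputable def etaCoeff (n : ℕ) : ℤ :=
  if Odd n then (PowerSeries.pentagonalSeries ℤ ^ 12).coeff (n / 2) else 0

lemma etaCoeff_two_mul_add_one (n : ℕ) :
    etaCoeff (2 * n + 1) = (PowerSeries.pentagonalSeries ℤ ^ 12).coeff n := by
  rw [etaCoeff, if_pos (odd_two_mul_add_one n)]
  rw [show (2 * n + 1) / 2 = n by omega]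

lemma etaCoeff_one : etaCoeff 1 = 1 := by
  have h := PowerSeries.coeff_pentagonalSeries_pentagonal ℤ 0
  rw [show pentagonal 0 = 0 by decide, PowerSeries.coeff_zero_eq_constantCoeff_apply] at h
  rw [etaCoeff, if_pos odd_one]
  simp [h]

lemma hasSum_eta_pow {z : ℂ} (hz : 0 < z.im) :
    HasSum (fun n ↦ (etaCoeff n : ℂ) * Function.Periodic.qParam 2 z ^ n) (η z ^ 12) := by
  have hinj : Function.Injective fun n : ℕ ↦ 2 * n + 1 := fun a b h ↦ by simpa using h
  rw [← hinj.hasSum_iff]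
  · have hq : ‖Function.Periodic.qParam 1 z‖ < 1 := by
      simpa using norm_qParam_lt_one 1 ⟨z, hz⟩
    have h := (hasSum_pentagonalSeries_pow_coeff hq 12).2.mul_left (Function.Periodic.qParam 2 z)
    have e1 : Function.Periodic.qParam 24 z ^ 12 = Function.Periodic.qParam 2 z := by
      simp only [Function.Periodic.qParam, ← Complex.exp_nat_mul]
      congr 1; push_cast; ring
    have e2 : Function.Periodic.qParam 2 z ^ 2 = Function.Periodic.qParam 1 z := by
      simp only [Function.Periodic.qParam, ← Complex.exp_nat_mul]
      congr 1; push_cast; ring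
    have e3 : η z ^ 12 = Function.Periodic.qParam 2 z *
        (∏' n, (1 - Function.Periodic.qParam 1 z ^ (n + 1))) ^ 12 := by
      rw [← e1, ← mul_pow]; rfl
    rw [e3]
    refine hasSum_of_eq (fun n ↦ ?_) h
    simp only [Function.comp, etaCoeff_two_mul_add_one, ← map_pentagonalSeries ℂ, ← map_pow,
      PowerSeries.coeff_map, pow_add, pow_mul, e2, eq_intCast]
    ring
  · intro n hn
    have : ¬ Odd n := fun ⟨m, hm⟩ ↦ hn ⟨m, hm.symm⟩
    simp [etaCoeff, this]

/-! ### Hecke relations for the coefficients -/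

section
variable {p : ℕ} [hp : Fact p.Prime]

lemma sum_exp_two_pi_I (n : ℕ) :
    ∑ b : ZMod p, exp (2 * π * I / p) ^ (b.val * n) = if p ∣ n then (p : ℂ) else 0 := by
  have hζ := Complex.isPrimitiveRoot_exp p hp.out.ne_zero
  have hsum : ∑ b : ZMod p, exp (2 * π * I / p) ^ (b.val * n) =
      ∑ b ∈ Finset.range p, (exp (2 * π * I / p) ^ n) ^ b := by
    refine Finset.sum_nbij' (fun b ↦ b.val) (fun b ↦ (b : ZMod p)) ?_ ?_ ?_ ?_ ?_
    · simp [ZMod.val_lt]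
    · simp
    · simp
    · intro b hb
      exact ZMod.val_natCast_of_lt (Finset.mem_range.1 hb)
    · intro b _
      rw [← pow_mul, mul_comm b.val]
  rw [hsum]
  split_ifs with h
  · rw [(hζ.pow_eq_one_iff_dvd n).2 h]; simp
  · have hζ' := hζ.pow_of_coprime n ((hp.out.coprime_iff_not_dvd.2 h).symm)
    exact hζ'.geom_sum_eq_zero hp.out.one_lt

lemma hasSum_heckeEta {z : ℂ} (hz : 0 < z.im) :
    HasSum (fun n ↦ ((p ^ 6 * (if p ∣ n then etaCoeff (n / p) else 0) +
      p * etaCoeff (p * n) : ℤ) : ℂ) * Function.Periodic.qParam 2 z ^ n) (heckeEta p z) := by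
  have hp0 : (p : ℂ) ≠ 0 := by exact_mod_cast hp.out.ne_zero
  have hinj : Function.Injective fun n : ℕ ↦ p * n :=
    fun a b h ↦ Nat.eq_of_mul_eq_mul_left hp.out.pos h
  have h1 : HasSum (fun n ↦ (p : ℂ) ^ 6 * ((if p ∣ n then etaCoeff (n / p) else 0 : ℤ) *
      Function.Periodic.qParam 2 z ^ n)) (p ^ 6 * η (p * z) ^ 12) := by
    refine HasSum.mul_left _ ?_
    rw [← hinj.hasSum_iff]
    · refine hasSum_of_eq (fun n ↦ ?_) (hasSum_eta_pow (im_natCast_mul_pos (p := p) hz))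
      simp only [Function.comp, dvd_mul_right, if_true, Nat.mul_div_cancel_left _ hp.out.pos]
      rw [pow_mul]
      congr 2
      simp only [Function.Periodic.qParam, ← Complex.exp_nat_mul]
      congr 1; ring
    · intro n hn
      have : ¬ p ∣ n := fun ⟨m, hm⟩ ↦ hn ⟨m, hm.symm⟩
      simp [this]
  have h2 : HasSum (fun n ↦ (p : ℂ) * etaCoeff (p * n) * Function.Periodic.qParam 2 z ^ n)
      (∑ b : ZMod p, η ((z + (2 * b.val : ℕ)) / p) ^ 12) := by
    have h := hasSum_sum (s := Finset.univ) fun (b : ZMod p) _ ↦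
      hasSum_eta_pow (im_add_div_pos (p := p) hz (2 * b.val))
    have hq (b : ZMod p) (n : ℕ) : Function.Periodic.qParam 2 ((z + (2 * b.val : ℕ)) / p) ^ n =
        Function.Periodic.qParam 2 (z / p) ^ n * exp (2 * π * I / p) ^ (b.val * n) := by
      rw [pow_mul, ← mul_pow]
      congr 1
      simp only [Function.Periodic.qParam, ← Complex.exp_nat_mul, ← Complex.exp_add]
      congr 1; push_cast; field_simp
    -- Orthogonality of the `p`-th roots of unity keeps only exponents divisible by `p`.
    have hterm : (fun n ↦ ∑ b : ZMod p, (etaCoeff n : ℂ) *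
        Function.Periodic.qParam 2 ((z + (2 * b.val : ℕ)) / p) ^ n) = fun n ↦ (etaCoeff n : ℂ) *
        Function.Periodic.qParam 2 (z / p) ^ n * if p ∣ n then (p : ℂ) else 0 := by
      ext n
      simp only [hq, ← mul_assoc, ← Finset.mul_sum, sum_exp_two_pi_I]
    rw [hterm, ← hinj.hasSum_iff] at h
    · refine hasSum_of_eq (fun n ↦ ?_) h
      simp only [Function.comp, dvd_mul_right, if_true]
      rw [pow_mul, show Function.Periodic.qParam 2 (z / p) ^ p = Function.Periodic.qParam 2 z by
        simp only [Function.Periodic.qParam, ← Complex.exp_nat_mul]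
        congr 1; field_simp]
      ring
    · intro n hn
      have : ¬ p ∣ n := fun ⟨m, hm⟩ ↦ hn ⟨m, hm.symm⟩
      simp [this]
  rw [heckeEta]
  refine hasSum_of_eq (fun n ↦ ?_) (h1.add h2)
  push_cast; ring

/-- Needed for uniqueness of `q`-expansions when coefficients are compared. -/
lemma analyticAt_cuspFunction_etaPow : AnalyticAt ℂ (cuspFunction 2 etaPow) 0 := by
  refine analyticAt_cuspFunction_zero two_pos ?_ ?_
    (isBoundedAtImInfty_of_hasSum_qExpansion two_pos fun τ ↦ hasSum_eta_pow τ.2)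
  · intro w
    have him : (w + (2 : ℝ)).im = w.im := by simp
    by_cases hw : 0 < w.im
    · simp only [Function.comp, ofComplex_apply_of_im_pos hw,
        ofComplex_apply_of_im_pos (him ▸ hw), etaPow]
      simpa using eta_pow_add_nat hw 2
    · simp only [Function.comp, ofComplex_apply_of_im_nonpos (not_lt.1 hw),
        ofComplex_apply_of_im_nonpos (him.trans_le (not_lt.1 hw))]
  · rw [UpperHalfPlane.mdifferentiable_iff]
    refine .congr (f := fun z ↦ η z ^ 12)
      (fun z hz ↦ ((differentiableAt_eta_of_mem_upperHalfPlaneSet hz).fun_pow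
        12).differentiableWithinAt) fun z hz ↦ ?_
    simp [etaPow, ofComplex_apply_of_im_pos hz]

/-- The form `η(2z) ^ 12` is an eigenform of the Hecke operator at every odd prime. -/
theorem etaCoeff_hecke (hodd : Odd p) (n : ℕ) :
    etaCoeff (p * n) + p ^ 5 * (if p ∣ n then etaCoeff (n / p) else 0) =
      etaCoeff p * etaCoeff n := by
  have hp0 : (p : ℤ) ≠ 0 := by exact_mod_cast hp.out.ne_zero
  obtain ⟨c, hc⟩ := exists_heckeEta_eq hodd
  have key (n : ℕ) : ((p ^ 6 * (if p ∣ n then etaCoeff (n / p) else 0) +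
      p * etaCoeff (p * n) : ℤ) : ℂ) = c * etaCoeff n := by
    have hsmul : c • etaPow = fun z : ℍ ↦ heckeEta p z := by
      ext z; simp [hc]
    have han : AnalyticAt ℂ (cuspFunction 2 (c • etaPow)) 0 := by
      rw [cuspFunction_smul analyticAt_cuspFunction_etaPow.continuousAt]
      exact analyticAt_const.smul analyticAt_cuspFunction_etaPow
    have h1 (τ : ℍ) : HasSum (fun n ↦ ((p ^ 6 * (if p ∣ n then etaCoeff (n / p) else 0) +
        p * etaCoeff (p * n) : ℤ) : ℂ) • Function.Periodic.qParam 2 τ ^ n) ((c • etaPow) τ) := by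
      rw [hsmul]
      exact hasSum_heckeEta τ.2
    have h2 (τ : ℍ) : HasSum (fun n ↦ (c * etaCoeff n) • Function.Periodic.qParam 2 τ ^ n)
        ((c • etaPow) τ) := by
      refine hasSum_of_eq (fun n ↦ ?_) ((hasSum_eta_pow τ.2).mul_left c)
      rw [smul_eq_mul, mul_assoc]
    have h3 := (hasFPowerSeriesOnBall_cuspFunction two_pos han h1).hasFPowerSeriesAt
    have h4 := (hasFPowerSeriesOnBall_cuspFunction two_pos han h2).hasFPowerSeriesAt
    simpa only [FormalMultilinearSeries.coeff_ofScalars] using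
      congrArg (FormalMultilinearSeries.coeff · n) (h3.eq_formalMultilinearSeries h4)
  -- The eigenvalue is read off at `n = 1`, where `a(1) = 1`.
  have hc1 : c = (p * etaCoeff p : ℤ) := by
    have := key 1
    rw [if_neg (hp.out.one_lt.ne' ∘ Nat.dvd_one.1), etaCoeff_one] at this
    simpa using this.symm
  have h := key n
  rw [hc1, ← Int.cast_mul, Int.cast_inj] at h
  refine mul_left_cancel₀ hp0 ?_
  linear_combination h

end

end EtaHecke

/-! ### Regular partitions modulo a prime -/

open PowerSeries PowerSeries.WithPiTopology in
/-- Modulo a prime `p`, the generating function of `p`-regular partitions is the `(p - 1)`-st power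
of the Euler product. -/
lemma mk_card_restricted_eq_pentagonalSeries_pow (p : ℕ) [hp : Fact p.Prime] :
    (PowerSeries.mk fun n ↦ ((Nat.Partition.restricted n (fun i ↦ ¬ p ∣ i)).card : ZMod p)) =
      pentagonalSeries (ZMod p) ^ (p - 1) := by
  let _ : TopologicalSpace (ZMod p) := ⊥
  have _ : DiscreteTopology (ZMod p) := ⟨rfl⟩
  have hE := hasProd_one_sub_X_pow (ZMod p)
  have hE0 : pentagonalSeries (ZMod p) ≠ 0 := by
    rw [← hE.tprod_eq]; exact tprod_one_sub_X_pow_ne_zero (ZMod p)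
  -- After multiplying by the Euler product `E`, Frobenius gives `E(X)^p = E(X^p)`.
  apply mul_right_cancel₀ hE0
  rw [← pow_succ, Nat.sub_add_cancel hp.out.one_le]
  have hE' : HasProd (fun n ↦ (1 - X ^ ((n + 1) * p) : (ZMod p)⟦X⟧))
      (pentagonalSeries (ZMod p) ^ p) := by
    have := hE.map (powMonoidHom p) (continuous_pow p)
    simp only [powMonoidHom_apply] at this
    convert this using 2 with n
    have : CharP (ZMod p)⟦X⟧ p := charP_of_injective_algebraMap (R := ZMod p) C_injective p
    simp [sub_pow_char, pow_mul]
  rw [← hE'.tprod_eq, Nat.Partition.powerSeriesMk_card_restricted_eq_tprod (ZMod p) (¬ p ∣ ·),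
    ← hE.tprod_eq, ← (Nat.Partition.multipliable_powerSeriesMk_card_restricted (ZMod p)
      (¬ p ∣ ·)).tprod_mul hE.multipliable]
  simp_rw [ite_not, ite_mul, pow_mul]
  conv_lhs =>
    enter [1, b]
    rw [tsum_pow_mul_one_sub_of_constantCoeff_eq_zero (by simp)]
  -- Factors on the left with `p ∤ i + 1` have cancelled to 1.
  refine tprod_eq_tprod_of_ne_one_bij (fun i ↦ (i.val + 1) * p - 1) ?_ ?_ ?_
  · intro a b h
    have h1 := Nat.mul_pos a.val.succ_pos hp.out.pos
    have h2 := Nat.mul_pos b.val.succ_pos hp.out.pos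
    have h3 : (a.val + 1) * p = (b.val + 1) * p := by grind
    exact Subtype.ext (by simpa [hp.out.ne_zero] using h3)
  · intro i hi
    have hd : p ∣ i + 1 := by by_contra hd; simp [hd] at hi
    obtain ⟨j, hj⟩ := hd
    have hj0 : j ≠ 0 := by rintro rfl; simp at hj
    have hij : (j - 1 + 1) * p - 1 = i := by
      rw [Nat.sub_add_cancel (Nat.one_le_iff_ne_zero.2 hj0), mul_comm, ← hj]; simp
    refine ⟨⟨j - 1, ?_⟩, hij⟩
    simp [hp.out.ne_zero]
  · intro i
    have : (i + 1) * p - 1 + 1 = (i + 1) * p := 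
      Nat.sub_add_cancel (Nat.mul_pos i.val.succ_pos hp.out.pos)
    simp [this, pow_mul]

/-! ### The congruences modulo 13 -/

lemma natCast_regularPartitionCount (n : ℕ) :
    (regularPartitionCount 13 n : ZMod 13) = etaCoeff (2 * n + 1) := by
  have : Fact (Nat.Prime 13) := ⟨by norm_num⟩
  have h := PowerSeries.ext_iff.1 (mk_card_restricted_eq_pentagonalSeries_pow 13) n
  rw [PowerSeries.coeff_mk, ← map_pentagonalSeries (ZMod 13), ← map_pow,
    PowerSeries.coeff_map] at h
  rw [etaCoeff_two_mul_add_one, regularPartitionCount, if_neg (by omega), Int.toNat_natCast]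
  simpa using h

lemma etaCoeff_mul_eq_zero {p : ℕ} (hp : p.Prime) (hodd : Odd p)
    (h0 : (etaCoeff p : ZMod 13) = 0) {n : ℕ} (hn : ¬ p ∣ n) :
    (etaCoeff (p * n) : ZMod 13) = 0 := by
  have : Fact p.Prime := ⟨hp⟩
  have h := congrArg (Int.cast : ℤ → ZMod 13) (etaCoeff_hecke hodd n)
  simpa [hn, h0] using h

lemma etaCoeff_sq_mul_eq_zero {p : ℕ} (hp : p.Prime) (hodd : Odd p)
    (h0 : (etaCoeff p : ZMod 13) = 0) {n : ℕ} (hn : (etaCoeff n : ZMod 13) = 0) :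
    (etaCoeff (p ^ 2 * n) : ZMod 13) = 0 := by
  have : Fact p.Prime := ⟨hp⟩
  have h := congrArg (Int.cast : ℤ → ZMod 13) (etaCoeff_hecke hodd (p * n))
  simpa [Nat.mul_div_cancel_left _ hp.pos, h0, hn, ← mul_assoc, ← sq] using h

lemma etaCoeff_prod_sq_mul_eq_zero {ι : Type*} (s : Finset ι) (p : ι → ℕ)
    (hp : ∀ i, (p i).Prime) (hodd : ∀ i, Odd (p i)) (h0 : ∀ i, (etaCoeff (p i) : ZMod 13) = 0)
    {n : ℕ} (hn : (etaCoeff n : ZMod 13) = 0) :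
    (etaCoeff ((∏ i ∈ s, p i ^ 2) * n) : ZMod 13) = 0 := by
  induction s using Finset.cons_induction with
  | empty => simpa using hn
  | cons i s hi ih =>
    rw [Finset.prod_cons, mul_assoc]
    exact etaCoeff_sq_mul_eq_zero (hp i) (hodd i) (h0 i) ih

theorem theorem1p3 (α n : ℕ) (p : Fin (α + 1) → ℕ)
    (hp : ∀ i, (p i).Prime) (hodd : ∀ i, Odd (p i))
    (hb : ∀ i, regularPartitionCount 13 (((p i : ℤ) - 1) / 2) ≡ 0 [MOD 13])
    (j : ℤ) (hj : ¬ j ≡ 0 [ZMOD (p (Fin.last α) : ℤ)]) :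
    regularPartitionCount 13
      ((∏ i : Fin (α + 1), (p i : ℤ) ^ 2) * n +
        ((∏ i : Fin α, (p i.castSucc : ℤ) ^ 2) * (p (Fin.last α) : ℤ) *
          (2 * j + (p (Fin.last α) : ℤ)) - 1) / 2) ≡ 0 [MOD 13] := by
  have h0 (i) : (etaCoeff (p i) : ZMod 13) = 0 := by
    obtain ⟨m, hm⟩ := hodd i
    have := (ZMod.natCast_eq_zero_iff _ 13).2 (Nat.modEq_zero_iff_dvd.1 (hb i))
    rw [show ((p i : ℤ) - 1) / 2 = m by rw [hm]; push_cast; omega,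
      natCast_regularPartitionCount, ← hm] at this
    exact this
  set q := p (Fin.last α) with hq
  obtain ⟨P, hP⟩ : ∃ P : ℕ, P = ∏ i : Fin α, p i.castSucc ^ 2 := ⟨_, rfl⟩
  have hPZ : ∏ i : Fin α, (p i.castSucc : ℤ) ^ 2 = P := by rw [hP]; push_cast; rfl
  rw [Fin.prod_univ_castSucc, hPZ, ← hq]
  have hPodd : Odd (P : ℤ) := by
    rw [Int.odd_coe_nat, hP]
    exact Finset.prod_induction _ Odd (fun _ _ ↦ Odd.mul) odd_one fun i _ ↦ (hodd _).pow
  have hqodd : Odd (q : ℤ) := (Int.odd_coe_nat _).2 (hodd _)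
  set M : ℤ := 2 * q * n + 2 * j + q with hM
  have hMq : ¬ (q : ℤ) ∣ M := by
    intro h
    have h2 : (q : ℤ) ∣ 2 * j := by
      have := dvd_sub h (Dvd.intro (2 * n + 1 : ℤ) rfl : (q : ℤ) ∣ q * (2 * n + 1))
      rwa [show M - q * (2 * n + 1) = 2 * j by rw [hM]; ring] at this
    have hcop : IsCoprime (q : ℤ) 2 := by
      exact_mod_cast Nat.isCoprime_iff_coprime.2 (hodd (Fin.last α)).coprime_two_right
    exact hj ((Int.modEq_zero_iff_dvd).2 (hcop.dvd_of_dvd_mul_left h2))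
  set N : ℤ := (P : ℤ) * q ^ 2 * n + (P * q * (2 * j + q) - 1) / 2 with hN
  have hNM : 2 * N + 1 = P * (q * M) := by
    have hodd' : Odd ((P : ℤ) * q * (2 * j + q)) :=
      (hPodd.mul hqodd).mul ((even_two_mul j).add_odd hqodd)
    obtain ⟨k, hk⟩ := hodd'
    rw [hN, hk, show (2 * k + 1 - 1) / 2 = k by omega, hM]
    linear_combination -hk
  -- A negative `j` can make the argument negative; the count is then 0 by convention.
  rcases lt_or_ge N 0 with hneg | hpos
  · rw [regularPartitionCount, if_pos hneg]
  · obtain ⟨K, hK⟩ := Int.eq_ofNat_of_zero_le hpos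
    have hMpos : 0 ≤ M := by
      by_contra hlt
      have : (P : ℤ) * (q * M) ≤ 0 :=
        mul_nonpos_of_nonneg_of_nonpos (by positivity)
          (mul_nonpos_of_nonneg_of_nonpos (by positivity) (not_le.1 hlt).le)
      omega
    obtain ⟨m, hm⟩ := Int.eq_ofNat_of_zero_le hMpos
    have hKm : 2 * K + 1 = P * (q * m) := by
      rw [hK, hm] at hNM
      exact_mod_cast hNM
    rw [hK, Nat.modEq_zero_iff_dvd, ← ZMod.natCast_eq_zero_iff, natCast_regularPartitionCount,
      hKm, hP]
    refine etaCoeff_prod_sq_mul_eq_zero _ (fun i : Fin α ↦ p i.castSucc) (fun _ ↦ hp _)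
      (fun _ ↦ hodd _) (fun _ ↦ h0 _) (etaCoeff_mul_eq_zero (hp _) (hodd _) (h0 _) ?_)
    intro hd
    exact hMq (hm ▸ Int.natCast_dvd_natCast.2 hd)
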